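/- Let $q$ be a prime power, let $n,m\ge 2$ be integers and let $1\le i\le n$. For $v\in\mathbb{F}_{q^m}^n$ let $\mathrm{rk}(v)$ be the $\mathbb{F}_q$-dimension of the $\mathbb{F}_q$-span of the entries of $v$. The rank-metric lattice $\mathscr{L}_i(n,m;q)$ is the set of $\mathbb{F}_{q^m}$-subspaces of $\mathbb{F}_{q^m}^n$ spanned by vectors of rank at most $i$, ordered by inclusion. For an $\mathbb{F}_{q^m}$-subspace $C\le\mathbb{F}_{q^m}^n$ let $d(C)=\min\{\mathrm{rk}(v): v\in C,\ v\ne 0\}$, where $d(\{0\})=\min\{n,m\}+1$ by convention, and let $\alpha_k(i,n,m;q)$ be the number of $k$-dimensional $C\le\mathbb{F}_{q^m}^n$ with $d(C)\ge i+1$. The critical exponent of $\mathscr{L}_i(n,m;q)$ is $$\mathrm{crit}(\mathscr{L}_i(n,m;q))=n-\max\{k\in\mathbb{Z}_{\ge 0}:\alpha_k(i,n,m;q)\neq 0\};$$ it is defined exactly when $i\le\min\{n,m\}$. The following hold. 1. If $n\le m$, then $\mathrm{crit}(\mathscr{L}_i(n,m;q))=i$. 2. If $n>m$ and $i\le m$,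 then $\mathrm{crit}(\mathscr{L}_i(n,m;q))\ge ni/m$. Furthermore, if $n>m$, then $\mathrm{crit}(\mathscr{L}_i(n,m;q))=ni/m$ whenever $m\mid ni$ and one of the following holds: - (a) $n=tm$ and $i=m-k$ for some nonnegative integers $t,k$; - (b) $n=mk/2$ for some nonnegative integer $k$, $m$ is even, and $i\in\{2,m-2\}$; - (c) $n=8$, $m=6$, $i=3$ and $q=2^h$ for some nonnegative integer $h\equiv 1 \pmod 6$; - (d) $n=8$, $m=4$, $i=3$ and $q=2^h$ for some odd nonnegative integer $h$. -/

import Mathlib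

/-! Throughout, `K` plays the role of `𝔽_q` and `L` of its extension `𝔽_{q^m}`, with
`q = Nat.card K` and `m = Module.finrank K L`; the ambient space `𝔽_{q^m}^n` is `Fin n → L`. -/

namespace RankMetric

/-- The rank weight of `v ∈ 𝔽_{q^m}^n`: the `𝔽_q`-dimension of the `𝔽_q`-span of its entries. -/
noncomputable def rk (K : Type*) {L : Type*} [Field K] [Field L] [Algebra K L] {n : ℕ}
    (v : Fin n → L) : ℕ :=
  Module.finrank K (Submodule.span K (Set.range v))

/-- The set `T_i(n,m;q)` of vectors of rank at most `i`. -/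
def lowRank (K L : Type*) [Field K] [Field L] [Algebra K L] (n i : ℕ) : Set (Fin n → L) :=
  {v | rk K v ≤ i}

/-- The elements of the rank-metric lattice `𝓛_i(n,m;q)`, ordered by inclusion: the subspaces of
`𝔽_{q^m}^n` spanned by finitely many vectors of rank at most `i`. -/
def lattice (K L : Type*) [Field K] [Field L] [Algebra K L] (n i : ℕ) :
    Set (Submodule L (Fin n → L)) :=
  {X | ∃ s : Set (Fin n → L), s.Finite ∧ s.Nonempty ∧ s ⊆ lowRank K L n i ∧
    X = Submodule.span L s}

open Classical in
/-- The minimum rank distance of a code `C ≤ 𝔽_{q^m}^n`; for the zero code it is `min(n,m) + 1`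
by convention. -/
noncomputable def minDist (K : Type*) {L : Type*} [Field K] [Field L] [Algebra K L] {n : ℕ}
    (C : Submodule L (Fin n → L)) : ℕ :=
  if C = ⊥ then min n (Module.finrank K L) + 1
  else sInf {r : ℕ | ∃ v ∈ C, v ≠ 0 ∧ rk K v = r}

/-- `α_k(i,n,m;q)`: the number of `k`-dimensional codes `C ≤ 𝔽_{q^m}^n` with `d(C) ≥ i + 1`. -/
noncomputable def numCodes (K L : Type*) [Field K] [Field L] [Algebra K L] (n i k : ℕ) : ℕ :=
  Set.ncard {C : Submodule L (Fin n → L) | Module.finrank L C = k ∧ i + 1 ≤ minDist K C}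

/-- The critical exponent of the rank-metric lattice `𝓛_i(n,m;q)`:
`n - max {k ≥ 0 : α_k(i,n,m;q) ≠ 0}`. The set is bounded above by `n`, so the subtraction does not
truncate; the maximum exists exactly when `i ≤ min(n,m)`, where the zero code gives `k = 0`. -/
noncomputable def crit (K L : Type*) [Field K] [Field L] [Algebra K L] (n i : ℕ) : ℕ :=
  n - sSup {k : ℕ | numCodes K L n i k ≠ 0}

end RankMetric

namespace RankMetric

open Module Submodule

/-! Write `m = [L : K]` and `q = #K`. For `i ≤ min n m` the critical exponent is the least
codimension of a linear code whose nonzero words all have rank above `i`. Lower bounds are Singleton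
arguments: forgetting `i` coordinates gives `dim C ≤ n - i`, and reducing entries modulo an
`i`-dimensional `K`-subspace of `L` gives `m * dim C ≤ n * (m - i)`. What remains is to construct
codes attaining them (`HasCode.crit_eq`).

Gabidulin codes attain the first bound for `n ≤ m`, and direct sums of square ones attain the second
when `m ∣ n`; this covers (a), (d) and the even multiples of `m / 2` in (b).

The other cases share one construction. Take an intermediate field `G`, its `q`-Frobenius `σ`, a
generator `ω` of `L` over `G`, and a `σ`-semilinear `g` on `G ^ r` with no proper nonzero stable
subspace (`exists_simple_semilinear`). The vectors `x + ω g(x)` form a `K`-space `U` in `L ^ r` of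
dimension `r * [G : K]`; a `K`-basis of `U` gives the columns of a matrix. As parity-check matrix,
with `[L : G] = 2` and `r = 3`, it excludes words of rank at most 2, because `U` is scattered. As
generator matrix, its words have the ranks of the maps `x ↦ h ⬝ (x + ω g(x))`, and trace duality
bounds these below by `m - 1` if `[L : G] = 2`, `r = 3`, and by `m - 2` if `[L : G] = 3`, `[G : K] =
2`, `r = 4`. The first two codes, of length `3m/2`, are padded with Gabidulin blocks to finish (b);
the third is (c). -/

/-- There is a linear code in `L ^ n` of dimension at least `k` whose nonzero words all have rank
greater than `i`. -/
def HasCode (K L : Type*) [Field K] [Field L] [Algebra K L] (n k i : ℕ) : Prop :=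
  ∃ C : Submodule L (Fin n → L), k ≤ finrank L C ∧ ∀ v ∈ C, v ≠ 0 → i < rk K v

/-! ### Singleton bounds, and the critical exponent in terms of codes -/

section Bounds

variable {K L : Type*} [Field K] [Field L] [Algebra K L] {n i k : ℕ}

theorem rk_le_card_of_range_subset [FiniteDimensional K L] (v : Fin n → L) (w : Fin i → L)
    (h : Set.range v ⊆ span K (Set.range w)) : rk K v ≤ i := by
  refine (Submodule.finrank_mono (span_le.2 h)).trans ?_
  simpa [Set.finrank] using finrank_range_le_card (R := K) w

theorem rk_le_finrank_of_forall_mem [FiniteDimensional K L] (v : Fin n → L) (A : Submodule K L)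
    (h : ∀ j, v j ∈ A) : rk K v ≤ finrank K A :=
  Submodule.finrank_mono (span_le.2 (by rintro _ ⟨j, rfl⟩; exact h j))

/-- The Singleton bound `dim C + i ≤ n` for codes whose nonzero words have rank exceeding `i`. -/
theorem finrank_add_le_of_forall_lt_rk [FiniteDimensional K L] (C : Submodule L (Fin n → L))
    (hin : i ≤ n) (hC : ∀ v ∈ C, v ≠ 0 → i < rk K v) : finrank L C + i ≤ n := by
  -- Forget the first `i` coordinates: a word killed by this is supported on `i` positions, so its
  -- rank is at most `i`.
  let e : Fin (n - i) → Fin n := fun j => ⟨j + i, by omega⟩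
  let f : C →ₗ[L] (Fin (n - i) → L) := (LinearMap.funLeft L L e).comp C.subtype
  have hf : Function.Injective f := by
    rw [← LinearMap.ker_eq_bot, LinearMap.ker_eq_bot']
    rintro ⟨v, hv⟩ h
    by_contra hne
    have hv0 : v ≠ 0 := fun h0 => hne (by simpa using h0)
    refine absurd (hC v hv hv0) (not_lt.2 ?_)
    refine rk_le_card_of_range_subset v (fun j : Fin i => v ⟨j, by omega⟩) ?_
    rintro _ ⟨j, rfl⟩
    by_cases hj : (j : ℕ) < i
    · exact subset_span ⟨⟨j, hj⟩, rfl⟩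
    · have := congrFun h ⟨j - i, by omega⟩
      have h2 : v j = 0 := by
        rw [Pi.zero_apply] at this
        convert this using 1
        simp only [f, e, LinearMap.comp_apply, LinearMap.funLeft_apply, Submodule.subtype_apply]
        congr 1
        ext
        simp; omega
      rw [h2]; exact zero_mem _
  have := LinearMap.finrank_le_finrank_of_injective hf
  simp at this
  omega

theorem exists_finrank_eq [FiniteDimensional K L] (h : i ≤ finrank K L) :
    ∃ A : Submodule K L, finrank K A = i := by
  have hb := (finBasis K L).linearIndependent.comp (Fin.castLE h) (Fin.castLE_injective h)
  exact ⟨_, by simpa using finrank_span_eq_card hb⟩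

/-- The Singleton bound for rank-metric codes of length exceeding the extension degree. -/
theorem finrank_mul_le_of_forall_lt_rk [FiniteDimensional K L] (C : Submodule L (Fin n → L))
    (him : i ≤ finrank K L) (hC : ∀ v ∈ C, v ≠ 0 → i < rk K v) :
    finrank K L * finrank L C ≤ n * (finrank K L - i) := by
  obtain ⟨A, hA⟩ := exists_finrank_eq him
  -- Reduction of the entries modulo `A` is injective on `C`, since a word with all entries in `A`
  -- has rank at most `i`.
  let f : C →ₗ[K] (Fin n → L ⧸ A) :=
    (LinearMap.pi fun j => A.mkQ.comp (LinearMap.proj j)).comp (C.subtype.restrictScalars K)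
  have hf : Function.Injective f := by
    rw [← LinearMap.ker_eq_bot, LinearMap.ker_eq_bot']
    rintro ⟨v, hv⟩ h
    by_contra hne
    have hv0 : v ≠ 0 := fun h0 => hne (by simpa using h0)
    refine absurd (hC v hv hv0) (not_lt.2 ?_)
    rw [← hA]
    refine rk_le_finrank_of_forall_mem v A fun j => ?_
    simpa [f] using congrFun h j
  have := LinearMap.finrank_le_finrank_of_injective hf
  rw [← finrank_mul_finrank K L C, Module.finrank_pi_fintype, Finset.sum_const,
    Submodule.finrank_quotient, hA] at this
  simpa using this

theorem forall_lt_rk_of_lt_minDist (C : Submodule L (Fin n → L)) (h : i + 1 ≤ minDist K C)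
    {v : Fin n → L} (hv : v ∈ C) (hv0 : v ≠ 0) : i < rk K v := by
  have hC : C ≠ ⊥ := by rintro rfl; exact hv0 (by simpa using hv)
  rw [minDist, if_neg hC] at h
  exact h.trans (Nat.sInf_le ⟨v, hv, hv0, rfl⟩)

theorem lt_minDist_of_forall_lt_rk (C : Submodule L (Fin n → L)) (hin : i ≤ n)
    (him : i ≤ finrank K L) (hC : ∀ v ∈ C, v ≠ 0 → i < rk K v) : i + 1 ≤ minDist K C := by
  unfold minDist
  split_ifs with h
  -- The zero code: the convention `min n m + 1` is where both bounds on `i` enter.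
  · simp [hin, him]
  · obtain ⟨v, hv, hv0⟩ := exists_mem_ne_zero_of_ne_bot h
    obtain ⟨w, hw, hw0, hr⟩ := Nat.sInf_mem (s := {r : ℕ | ∃ v ∈ C, v ≠ 0 ∧ rk K v = r})
      ⟨_, v, hv, hv0, rfl⟩
    rw [← hr]
    exact hC w hw hw0

theorem numCodes_ne_zero_iff [Finite L] :
    numCodes K L n i k ≠ 0 ↔
      ∃ C : Submodule L (Fin n → L), finrank L C = k ∧ i + 1 ≤ minDist K C := by
  have : Finite (Submodule L (Fin n → L)) := inferInstance
  rw [numCodes, Ne, Set.ncard_eq_zero (Set.toFinite _), ← Ne, ← Set.nonempty_iff_ne_empty]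
  rfl

theorem exists_code_of_crit [Finite L] (hin : i ≤ n) (him : i ≤ finrank K L) :
    ∃ C : Submodule L (Fin n → L), (∀ v ∈ C, v ≠ 0 → i < rk K v) ∧
      crit K L n i = n - finrank L C := by
  have hne : {k : ℕ | numCodes K L n i k ≠ 0}.Nonempty :=
    ⟨0, numCodes_ne_zero_iff.2 ⟨⊥, by simp, lt_minDist_of_forall_lt_rk _ hin him
      fun v hv h0 => absurd (by simpa using hv) h0⟩⟩
  have hb : BddAbove {k : ℕ | numCodes K L n i k ≠ 0} := by
    refine ⟨n, fun k hk => ?_⟩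
    obtain ⟨C, rfl, -⟩ := numCodes_ne_zero_iff.1 hk
    simpa using C.finrank_le
  obtain ⟨C, hC, hd⟩ := numCodes_ne_zero_iff.1 (Nat.sSup_mem hne hb)
  exact ⟨C, fun v hv h0 => forall_lt_rk_of_lt_minDist C hd hv h0, by rw [crit, ← hC]⟩

theorem HasCode.crit_le [Finite L] (hin : i ≤ n) (him : i ≤ finrank K L)
    (h : HasCode K L n k i) : crit K L n i + k ≤ n := by
  obtain ⟨C, hk, hC⟩ := h
  have hb : BddAbove {k : ℕ | numCodes K L n i k ≠ 0} := by
    refine ⟨n, fun k hk => ?_⟩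
    obtain ⟨C, rfl, -⟩ := numCodes_ne_zero_iff.1 hk
    simpa using C.finrank_le
  have h1 : finrank L C ≤ sSup {k : ℕ | numCodes K L n i k ≠ 0} :=
    le_csSup hb (numCodes_ne_zero_iff.2 ⟨C, rfl, lt_minDist_of_forall_lt_rk C hin him hC⟩)
  have h2 : finrank L C ≤ n := by simpa using C.finrank_le
  have h3 : sSup {k : ℕ | numCodes K L n i k ≠ 0} ≤ n :=
    csSup_le' fun k hk => by
      obtain ⟨C, rfl, -⟩ := numCodes_ne_zero_iff.1 hk
      simpa using C.finrank_le
  unfold crit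
  omega

end Bounds

/-! ### Direct sums of codes -/

section Constructions

variable {K L : Type*} [Field K] [Field L] [Algebra K L] {n i k : ℕ}

theorem rk_comp_le [FiniteDimensional K L] {n' : ℕ} (v : Fin n → L) (e : Fin n' → Fin n) :
    rk K (v ∘ e) ≤ rk K v :=
  Submodule.finrank_mono (span_mono (Set.range_comp_subset_range e v))

theorem HasCode.zero : HasCode K L n 0 i :=
  ⟨⊥, by simp, fun v hv h0 => absurd (by simpa using hv) h0⟩

/-- A nonzero word has a nonzero block, and its rank is at least that of the block. -/
theorem HasCode.append [FiniteDimensional K L] {n' k' : ℕ} (h : HasCode K L n k i)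
    (h' : HasCode K L n' k' i) : HasCode K L (n + n') (k + k') i := by
  obtain ⟨C, hk, hC⟩ := h
  obtain ⟨D, hk', hD⟩ := h'
  let p := LinearMap.funLeft L L (Fin.castAdd n' : Fin n → Fin (n + n'))
  let p' := LinearMap.funLeft L L (Fin.natAdd n : Fin n' → Fin (n + n'))
  refine ⟨C.comap p ⊓ D.comap p', ?_, ?_⟩
  · let f : (C × D) →ₗ[L] ↥(C.comap p ⊓ D.comap p') :=
      { toFun := fun x => ⟨Fin.append x.1 x.2, by
          constructor
          · have : p (Fin.append x.1 x.2) = x.1 := by ext j; simp [p, LinearMap.funLeft_apply]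
            simp [this]
          · have : p' (Fin.append x.1 x.2) = x.2 := by ext j; simp [p', LinearMap.funLeft_apply]
            simp [this]⟩
        map_add' := fun x y => by
          ext j; refine Fin.addCases (fun j => ?_) (fun j => ?_) j <;> simp
        map_smul' := fun a x => by
          ext j; refine Fin.addCases (fun j => ?_) (fun j => ?_) j <;> simp }
    have hf : Function.Injective f := by
      rintro ⟨⟨x, hx⟩, ⟨y, hy⟩⟩ ⟨⟨x', hx'⟩, ⟨y', hy'⟩⟩ h
      have h1 : Fin.append x y = Fin.append x' y' := congrArg Subtype.val h
      have hxx : x = x' := by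
        ext j; simpa using congrFun h1 (Fin.castAdd n' j)
      have hyy : y = y' := by
        ext j; simpa using congrFun h1 (Fin.natAdd n j)
      subst hxx hyy; rfl
    have := LinearMap.finrank_le_finrank_of_injective hf
    rw [finrank_prod] at this
    omega
  · rintro v ⟨hv, hv'⟩ h0
    by_cases hp : p v = 0
    · by_cases hp' : p' v = 0
      · refine absurd (funext fun j => ?_) h0
        refine Fin.addCases (fun j => ?_) (fun j => ?_) j
        · exact congrFun hp j
        · exact congrFun hp' j
      · exact (hD _ hv' hp').trans_le (rk_comp_le v _)
    · exact (hC _ hv hp).trans_le (rk_comp_le v _)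

theorem HasCode.replicate [FiniteDimensional K L] (h : HasCode K L n k i) (t : ℕ) :
    HasCode K L (t * n) (t * k) i := by
  induction t with
  | zero => simpa using HasCode.zero
  | succ t ih => simpa [Nat.succ_mul] using ih.append h

end Constructions

/-! ### Gabidulin codes -/

section Gabidulin

variable {K L : Type*} [Field K] [Field L] [Algebra K L] {n i k : ℕ}

theorem rk_map {X : Type*} [AddCommGroup X] [Module K X] (f : X →ₗ[K] L) (b : Fin n → X) :
    rk K (fun j => f (b j)) = finrank K ((span K (Set.range b)).map f) := by
  rw [Submodule.map_span, ← Set.range_comp]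
  rfl

/-- Rank-nullity on the span of `b`: evaluation at `n` independent points loses at most the nullity
of `f`. -/
theorem le_rk_map_add_finrank_ker {X : Type*} [AddCommGroup X] [Module K X]
    [FiniteDimensional K X] (f : X →ₗ[K] L) {b : Fin n → X} (hb : LinearIndependent K b) :
    n ≤ rk K (fun j => f (b j)) + finrank K (LinearMap.ker f) := by
  set S := span K (Set.range b)
  have h := LinearMap.finrank_range_add_finrank_ker (f.domRestrict S)
  have h1 : LinearMap.range (f.domRestrict S) = S.map f := by
    rw [LinearMap.domRestrict, LinearMap.range_comp, Submodule.range_subtype]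
  have h2 : finrank K (LinearMap.ker (f.domRestrict S)) ≤ finrank K (LinearMap.ker f) := by
    rw [← Submodule.finrank_map_subtype_eq S]
    refine Submodule.finrank_mono ?_
    rintro _ ⟨x, hx, rfl⟩
    exact hx
  have h3 : finrank K S = n := by simpa using finrank_span_eq_card hb
  rw [rk_map, ← h1]
  omega

-- Kernel elements are roots of the nonzero polynomial `∑ a_l X^(q^l)` of degree at most `q^(k-1)`.
open Polynomial in
theorem finrank_ker_sum_frobenius_lt [Fintype K] [Finite L] (a : Fin k → L) (ha : a ≠ 0) :
    finrank K (LinearMap.ker (∑ l, a l • ((FiniteField.frobeniusAlgHom K L) ^ (l : ℕ)).toLinearMap))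
      < k := by
  classical
  set q := Fintype.card K with hq
  have hq1 : 1 < q := Fintype.one_lt_card
  set f := ∑ l, a l • ((FiniteField.frobeniusAlgHom K L) ^ (l : ℕ)).toLinearMap with hf
  let P : L[X] := ∑ l : Fin k, C (a l) * X ^ (q ^ (l : ℕ))
  obtain ⟨l₀, hl₀⟩ : ∃ l, a l ≠ 0 := by
    by_contra! h; exact ha (funext h)
  have hP : P ≠ 0 := by
    intro h
    have h1 : P.coeff (q ^ (l₀ : ℕ)) = a l₀ := by
      simp only [P, finsetSum_coeff, coeff_C_mul, coeff_X_pow]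
      rw [Finset.sum_eq_single l₀]
      · simp
      · intro b _ hb
        rw [if_neg, mul_zero]
        intro h2
        exact hb (Fin.ext (Nat.pow_right_injective hq1 h2).symm)
      · simp
    rw [h] at h1
    exact hl₀ (by simpa using h1.symm)
  have hdeg : P.natDegree ≤ q ^ (k - 1) := by
    refine natDegree_sum_le_of_forall_le _ _ fun l _ => ?_
    refine (natDegree_C_mul_X_pow_le _ _).trans ?_
    exact Nat.pow_le_pow_right (by omega) (by omega)
  have hfrob : ∀ (l : ℕ) (x : L), ((FiniteField.frobeniusAlgHom K L) ^ l) x = x ^ q ^ l := by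
    intro l x
    induction l with
    | zero => simp
    | succ l ih => rw [pow_succ', AlgHom.mul_apply, ih, FiniteField.frobeniusAlgHom_apply,
        ← pow_mul, ← pow_succ]
  have hsub : (LinearMap.ker f : Set L) ⊆ P.rootSet L := by
    intro x hx
    rw [mem_rootSet]
    refine ⟨hP, ?_⟩
    have : f x = 0 := hx
    simpa only [P, f, LinearMap.sum_apply, LinearMap.smul_apply, AlgHom.toLinearMap_apply, hfrob,
      smul_eq_mul, map_sum, map_mul, map_pow, aeval_C, aeval_X, Algebra.algebraMap_self,
      RingHom.id_apply] using this
  have h1 : Nat.card (LinearMap.ker f) ≤ q ^ (k - 1) := by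
    have := Set.ncard_le_ncard hsub (Set.toFinite _)
    refine (this.trans ?_).trans hdeg
    rw [rootSet_def, Set.ncard_coe_finset]
    exact (Multiset.toFinset_card_le _).trans ((card_roots' _).trans (by simp))
  rw [Module.natCard_eq_pow_finrank (K := K), Nat.card_eq_fintype_card] at h1
  have := (Nat.pow_le_pow_iff_right hq1).1 h1
  have := l₀.2
  omega

/-- Gabidulin codes. -/
theorem HasCode.gabidulin [Fintype K] [Finite L] (hnm : n ≤ finrank K L) :
    HasCode K L n (n - i) i := by
  have : Module.Finite K L := Module.Finite.of_finite
  rcases Nat.eq_zero_or_pos (n - i) with h0 | h0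
  · rw [h0]; exact HasCode.zero
  have hb := (finBasis K L).linearIndependent.comp (Fin.castLE hnm) (Fin.castLE_injective hnm)
  set b := finBasis K L ∘ Fin.castLE hnm with hbdef
  -- Words are values of linearized polynomials at `n` independent points; the nullity is at most `n
  -- - i - 1`, so the rank is at least `i + 1`.
  let E : (Fin (n - i) → L) →ₗ[L] (Fin n → L) :=
    { toFun := fun a j =>
        (∑ l : Fin (n - i), a l • ((FiniteField.frobeniusAlgHom K L) ^ (l : ℕ)).toLinearMap) (b j)
      map_add' := fun a a' => by ext j; simp [add_mul, Finset.sum_add_distrib]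
      map_smul' := fun c a => by ext j; simp [mul_assoc, Finset.mul_sum] }
  have key : ∀ a, a ≠ 0 → i < rk K (E a) := by
    intro a ha
    have h1 := le_rk_map_add_finrank_ker
      (∑ l : Fin (n - i), a l • ((FiniteField.frobeniusAlgHom K L) ^ (l : ℕ)).toLinearMap) hb
    have h2 := finrank_ker_sum_frobenius_lt (K := K) a ha
    change i < rk K (fun j =>
      (∑ l : Fin (n - i), a l • ((FiniteField.frobeniusAlgHom K L) ^ (l : ℕ)).toLinearMap) (b j))
    omega
  refine ⟨LinearMap.range E, ?_, ?_⟩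
  · rw [LinearMap.finrank_range_of_inj]
    · simp
    · rw [← LinearMap.ker_eq_bot, LinearMap.ker_eq_bot']
      intro a h
      by_contra ha
      have := key a ha
      rw [h] at this
      have h3 : rk K (0 : Fin n → L) = 0 := by
        rw [rk, Submodule.finrank_eq_zero, span_eq_bot]
        rintro _ ⟨j, rfl⟩; rfl
      omega
  · rintro _ ⟨a, rfl⟩ h
    exact key a (by rintro rfl; simp at h)

end Gabidulin

/-! ### Semilinear maps without proper nonzero stable subspaces -/

section SimpleSemilinear

open Polynomial

theorem exists_irreducible_natDegree_eq (K : Type*) [Field K] [Finite K] {r : ℕ} (hr : 1 ≤ r) :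
    ∃ f : K[X], Irreducible f ∧ f.Monic ∧ f.natDegree = r := by
  obtain ⟨p, hp⟩ := CharP.exists K
  have : Fact p.Prime := ⟨CharP.char_is_prime K p⟩
  have : NeZero r := ⟨by omega⟩
  let M := FiniteField.Extension K p r
  obtain ⟨x, hx⟩ := Field.exists_primitive_element K M
  have hi : IsIntegral K x := IsIntegral.of_finite K x
  refine ⟨minpoly K x, minpoly.irreducible hi, minpoly.monic hi, ?_⟩
  rw [← IntermediateField.adjoin.finrank hi, hx, IntermediateField.finrank_top',
    FiniteField.finrank_extension]

variable {K G : Type*} [Field K] [Fintype K] [Field G] [Fintype G] [Algebra K G]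

theorem exists_algebraMap_eq_of_frobenius (R : Type*) [Field R] [Algebra K R] (x : R)
    (hx : x ^ Fintype.card K = x) : ∃ a, algebraMap K R a = x := by
  classical
  have h1 : 1 < Fintype.card K := Fintype.one_lt_card
  have hP : (X ^ Fintype.card K - X : R[X]) ≠ 0 := FiniteField.X_pow_card_sub_X_ne_zero R h1
  have hsub : Finset.univ.image (algebraMap K R) ⊆ (X ^ Fintype.card K - X : R[X]).roots.toFinset := by
    intro y hy
    obtain ⟨a, -, rfl⟩ := Finset.mem_image.1 hy
    simp [hP, ← map_pow, FiniteField.pow_card]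
  have hcard : (X ^ Fintype.card K - X : R[X]).roots.toFinset.card ≤
      (Finset.univ.image (algebraMap K R)).card := by
    rw [Finset.card_image_of_injective _ (algebraMap K R).injective, Finset.card_univ]
    refine (Multiset.toFinset_card_le _).trans ((card_roots' _).trans ?_)
    rw [FiniteField.X_pow_card_sub_X_natDegree_eq R h1]
  have h2 := Finset.eq_of_subset_of_card_le hsub hcard
  have h3 : x ∈ (X ^ Fintype.card K - X : R[X]).roots.toFinset := by simp [hP, hx]
  rw [← h2] at h3
  obtain ⟨a, -, ha⟩ := Finset.mem_image.1 h3
  exact ⟨a, ha⟩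

variable (G) in
/-- The `#G`-power Frobenius of the algebraic closure of `G`, as a `G`-linear map. -/
noncomputable def closureFrobenius : Module.End G (AlgebraicClosure G) :=
  (FiniteField.frobeniusAlgHom G (AlgebraicClosure G)).toLinearMap

theorem closureFrobenius_pow_apply (j : ℕ) (x : AlgebraicClosure G) :
    (closureFrobenius G ^ j) x = x ^ Fintype.card G ^ j := by
  induction j with
  | zero => simp
  | succ j ih =>
    rw [pow_succ', Module.End.mul_apply, ih, closureFrobenius, AlgHom.toLinearMap_apply,
      FiniteField.frobeniusAlgHom_apply, ← pow_mul, ← pow_succ]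

/-- With `Q = #G`, the kernel is the zero set of `∑ f_l X^(Q^l)`, whose derivative is the nonzero
constant `f_0`; hence all its roots are simple. -/
theorem natCard_ker_aeval_closureFrobenius (f : G[X]) (hf : f.Monic) (h0 : f.coeff 0 ≠ 0) :
    Nat.card (LinearMap.ker (aeval (closureFrobenius G) f)) = Fintype.card G ^ f.natDegree := by
  set Q := Fintype.card G with hQ
  have hQ1 : 1 < Q := Fintype.one_lt_card
  let P : (AlgebraicClosure G)[X] :=
    ∑ l ∈ Finset.range (f.natDegree + 1), C (algebraMap G _ (f.coeff l)) * X ^ (Q ^ l)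
  have hsub : (LinearMap.ker (aeval (closureFrobenius G) f) : Set (AlgebraicClosure G)) =
      {x | P.eval x = 0} := by
    ext x
    simp only [SetLike.mem_coe, LinearMap.mem_ker, Set.mem_ofPred_eq]
    rw [aeval_eq_sum_range]
    simp only [P, eval_finsetSum, LinearMap.sum_apply, LinearMap.smul_apply,
      closureFrobenius_pow_apply, eval_mul, eval_C, eval_pow, eval_X]
    simp only [Algebra.smul_def]
    rfl
  have hcoeff : P.coeff (Q ^ f.natDegree) = 1 := by
    simp only [P, finsetSum_coeff, coeff_C_mul, coeff_X_pow]
    rw [Finset.sum_eq_single f.natDegree]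
    · simp [hf.coeff_natDegree]
    · intro b _ hb
      rw [if_neg, mul_zero]
      exact fun h2 => hb (Nat.pow_right_injective hQ1 h2).symm
    · simp
  have hdeg : P.natDegree = Q ^ f.natDegree := by
    refine le_antisymm ?_ (le_natDegree_of_ne_zero (by rw [hcoeff]; exact one_ne_zero))
    refine natDegree_sum_le_of_forall_le _ _ fun l hl => ?_
    refine (natDegree_C_mul_X_pow_le _ _).trans ?_
    exact Nat.pow_le_pow_right (by omega) (Nat.lt_succ_iff.1 (Finset.mem_range.1 hl))
  have hP : P ≠ 0 := by rintro h; rw [h] at hcoeff; simp at hcoeff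
  have hQ0 : (Q : AlgebraicClosure G) = 0 := by
    have := congrArg (algebraMap G (AlgebraicClosure G)) (FiniteField.cast_card_eq_zero G)
    rwa [map_natCast, map_zero] at this
  have hder : derivative P = C (algebraMap G _ (f.coeff 0)) := by
    simp only [P, derivative_sum, derivative_C_mul_X_pow]
    rw [Finset.sum_eq_single 0]
    · simp
    · intro b _ hb
      simp [hQ0, hb]
    · simp
  have hsep : P.Separable := by
    rw [Polynomial.separable_def, hder]
    exact ⟨0, C (algebraMap G _ (f.coeff 0))⁻¹, by
      rw [zero_mul, zero_add, ← C_mul, inv_mul_cancel₀, C_1]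
      simpa using h0⟩
  have h1 : Nat.card (P.rootSet (AlgebraicClosure G)) = P.natDegree := by
    rw [Nat.card_eq_fintype_card]
    exact card_rootSet_eq_natDegree hsep (IsAlgClosed.splits _)
  have h2 : P.rootSet (AlgebraicClosure G) = {x | P.eval x = 0} := by
    ext x
    simp [mem_rootSet, hP]
  rw [← hdeg, ← h1, h2, ← hsub]
  rfl

/-- The `q`-power map commutes with the `#G`-power map and twists scalars by `σ`. -/
theorem aeval_closureFrobenius_map (p : G[X]) (y : AlgebraicClosure G) :
    aeval (closureFrobenius G) (p.map (FiniteField.frobeniusAlgHom K G : G →+* G))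
      (y ^ Fintype.card K) = (aeval (closureFrobenius G) p y) ^ Fintype.card K := by
  induction p using Polynomial.induction_on' with
  | add p p' hp hp' =>
    rw [Polynomial.map_add, map_add, map_add, LinearMap.add_apply, LinearMap.add_apply, hp, hp']
    exact (map_add (FiniteField.frobeniusAlgHom K (AlgebraicClosure G)) _ _).symm
  | monomial n a =>
    rw [map_monomial, aeval_monomial, aeval_monomial, Module.End.mul_apply, Module.End.mul_apply,
      closureFrobenius_pow_apply, closureFrobenius_pow_apply, Module.algebraMap_end_apply,
      Module.algebraMap_end_apply, Algebra.smul_def, Algebra.smul_def, mul_pow]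
    simp only [RingHom.coe_coe, FiniteField.frobeniusAlgHom_apply, map_pow]
    rw [← pow_mul, ← pow_mul, mul_comm (Fintype.card K)]

theorem map_map_frobenius {E : Type*} [Field E] [Algebra K E] (f : K[X]) :
    (f.map (algebraMap K E)).map (FiniteField.frobeniusAlgHom K E : E →+* E) =
      f.map (algebraMap K E) := by
  rw [Polynomial.map_map]
  congr 1
  ext a
  simp

/-- A Frobenius-stable subspace annihilated by an irreducible polynomial over `K` in the
`G`-linear Frobenius has dimension at least the degree of the polynomial. -/
theorem natDegree_le_finrank_of_stable (f : K[X]) (hf : Irreducible f)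
    (Y : Submodule G (AlgebraicClosure G)) [FiniteDimensional G Y] (hY : Y ≠ ⊥)
    (hYf : Y ≤ LinearMap.ker (aeval (closureFrobenius G) (f.map (algebraMap K G))))
    (hst : ∀ y ∈ Y, y ^ Fintype.card K ∈ Y) : f.natDegree ≤ finrank G Y := by
  have hpow : ∀ j : ℕ, ∀ y ∈ Y, y ^ Fintype.card K ^ j ∈ Y := by
    intro j y hy
    induction j with
    | zero => simpa using hy
    | succ j ih => rw [pow_succ, pow_mul]; exact hst _ ih
  have hYQ : ∀ y ∈ Y, closureFrobenius G y ∈ Y := by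
    intro y hy
    have h1 := closureFrobenius_pow_apply 1 y
    rw [pow_one, pow_one, Module.card_eq_pow_finrank (K := K) (V := G)] at h1
    rw [h1]
    exact hpow _ y hy
  let Φ : Module.End G Y := (closureFrobenius G).restrict hYQ
  have hcoe : ∀ (p : G[X]) (y : Y), ((aeval Φ p y : Y) : AlgebraicClosure G) =
      aeval (closureFrobenius G) p (y : AlgebraicClosure G) := by
    intro p y
    induction p using Polynomial.induction_on' with
    | add p p' hp hp' => simp [hp, hp']
    | monomial n a =>
      rw [aeval_monomial, aeval_monomial, Module.End.mul_apply, Module.End.mul_apply,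
        Module.algebraMap_end_apply, Module.algebraMap_end_apply, Submodule.coe_smul]
      congr 1
      induction n with
      | zero => simp
      | succ n ih => rw [pow_succ', pow_succ', Module.End.mul_apply, Module.End.mul_apply, ← ih]; rfl
  have : Finite Y := Module.finite_of_finite G
  have hsurj : ∀ y : Y, ∃ z : Y, (z : AlgebraicClosure G) ^ Fintype.card K = y := by
    have hinj : Function.Injective (fun y : Y => (⟨(y : AlgebraicClosure G) ^ Fintype.card K,
        hst y y.2⟩ : Y)) := by
      intro y z h
      apply Subtype.ext
      exact (FiniteField.frobeniusAlgHom K (AlgebraicClosure G)).toRingHom.injective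
        (congrArg Subtype.val h)
    intro y
    obtain ⟨z, hz⟩ := Finite.surjective_of_injective hinj y
    exact ⟨z, congrArg Subtype.val hz⟩
  have hint : IsIntegral G Φ := Algebra.IsIntegral.isIntegral Φ
  have hmon : (minpoly G Φ).Monic := minpoly.monic hint
  -- The `q`-power map is bijective on `Y` and commutes with `Φ`, so the twisted minimal polynomial
  -- also kills `Φ`. Its coefficients are thus Frobenius-fixed, that is, in `K`.
  have hdvd : minpoly G Φ ∣ (minpoly G Φ).map (FiniteField.frobeniusAlgHom K G : G →+* G) := by
    apply minpoly.dvd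
    ext y
    obtain ⟨z, hz⟩ := hsurj y
    have h0 : aeval Φ (minpoly G Φ) z = 0 := LinearMap.congr_fun (minpoly.aeval G Φ) z
    rw [hcoe, ← hz, aeval_closureFrobenius_map, ← hcoe, h0]
    simp
  have heq : (minpoly G Φ).map (FiniteField.frobeniusAlgHom K G : G →+* G) = minpoly G Φ :=
    (eq_of_monic_of_dvd_of_natDegree_le hmon (hmon.map _) hdvd (natDegree_map_le))
  have hlift : minpoly G Φ ∈ lifts (algebraMap K G) := by
    rw [lifts_iff_coeff_lifts]
    intro j
    apply exists_algebraMap_eq_of_frobenius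
    have := congrArg (fun p => coeff p j) heq
    simpa using this
  obtain ⟨μ, hμ, hμd, hμm⟩ := lifts_and_natDegree_eq_and_monic hlift hmon
  have hμf : μ ∣ f := by
    rw [← Polynomial.map_dvd_map' (algebraMap K G), hμ]
    apply minpoly.dvd
    ext y
    rw [hcoe]
    simpa using hYf y.2
  have hle : (minpoly G Φ).natDegree ≤ finrank G Y := by
    rw [← LinearMap.charpoly_natDegree Φ]
    exact natDegree_le_of_dvd (LinearMap.minpoly_dvd_charpoly Φ) (LinearMap.charpoly_monic Φ).ne_zero
  -- Irreducibility leaves a unit, which forces `Y = 0`, or an associate of `f`.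
  rcases hf.dvd_iff.1 hμf with hu | ha
  · exfalso
    have h1 : μ = 1 := hμm.eq_one_of_isUnit hu
    rw [h1, Polynomial.map_one] at hμ
    have h2 := minpoly.aeval G Φ
    rw [← hμ, map_one] at h2
    apply hY
    rw [eq_bot_iff]
    intro y hy
    have h3 := congrArg Subtype.val (LinearMap.congr_fun h2 (⟨y, hy⟩ : Y))
    simpa using h3
  · rwa [natDegree_eq_of_degree_eq (degree_eq_degree_of_associated ha), hμd]

/-- Over an extension `G` of the finite field `K`, there are Frobenius-semilinear maps of `G ^ r`
without proper nonzero stable subspaces. -/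
theorem exists_simple_semilinear (K G : Type*) [Field K] [Fintype K] [Field G] [Fintype G]
    [Algebra K G] {r : ℕ} (hr : 2 ≤ r) :
    ∃ g : (Fin r → G) →ₛₗ[(FiniteField.frobeniusAlgHom K G : G →+* G)] (Fin r → G),
      ∀ Y : Submodule G (Fin r → G), (∀ y ∈ Y, g y ∈ Y) → Y = ⊥ ∨ Y = ⊤ := by
  obtain ⟨f, hf, hfm, hfd⟩ := exists_irreducible_natDegree_eq K (r := r) (by omega)
  -- Needed for separability; `r ≥ 2` excludes an associate of `X`.
  have hf0 : f.coeff 0 ≠ 0 := by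
    intro h
    have h1 : X ∣ f := X_dvd_iff.2 h
    have h2 := natDegree_eq_of_degree_eq
      (degree_eq_degree_of_associated (irreducible_X.associated_of_dvd hf h1))
    rw [natDegree_X] at h2
    omega
  set F := f.map (algebraMap K G) with hF
  set V := LinearMap.ker (aeval (closureFrobenius G) F) with hV
  have hcard : Nat.card V = Fintype.card G ^ r := by
    rw [hV, natCard_ker_aeval_closureFrobenius F (hfm.map _) (by simpa [hF] using hf0), hF,
      natDegree_map, hfd]
  have hVfin : Finite V := Nat.finite_of_card_ne_zero (by rw [hcard]; positivity)
  have : Module.Finite G V := Module.Finite.of_finite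
  have hfr : finrank G V = r := by
    rw [Module.natCard_eq_pow_finrank (K := G), Nat.card_eq_fintype_card] at hcard
    exact Nat.pow_right_injective Fintype.one_lt_card hcard
  have hst : ∀ y ∈ V, y ^ Fintype.card K ∈ V := by
    intro y hy
    rw [hV, LinearMap.mem_ker] at hy ⊢
    rw [hF, ← map_map_frobenius, aeval_closureFrobenius_map, hy, zero_pow Fintype.card_ne_zero]
  let e : V ≃ₗ[G] (Fin r → G) := LinearEquiv.ofFinrankEq _ _ (by simp [hfr])
  -- The `q`-power map on the `r`-dimensional `V`, in coordinates.
  let g : (Fin r → G) →ₛₗ[(FiniteField.frobeniusAlgHom K G : G →+* G)] (Fin r → G) :=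
    { toFun := fun v => e ⟨(e.symm v : AlgebraicClosure G) ^ Fintype.card K, hst _ (e.symm v).2⟩
      map_add' := fun v w => by
        rw [← map_add]
        congr 1
        apply Subtype.ext
        rw [map_add]
        exact map_add (FiniteField.frobeniusAlgHom K (AlgebraicClosure G)) _ _
      map_smul' := fun a v => by
        rw [← map_smul]
        congr 1
        apply Subtype.ext
        have h : (e.symm (a • v) : AlgebraicClosure G) = algebraMap G _ a * e.symm v := by
          rw [map_smul, Submodule.coe_smul, Algebra.smul_def]
        rw [Submodule.coe_smul]
        change (e.symm (a • v) : AlgebraicClosure G) ^ Fintype.card K = _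
        rw [h, mul_pow, Algebra.smul_def]
        simp }
  refine ⟨g, fun Y hY => ?_⟩
  by_cases hbot : Y = ⊥
  · exact Or.inl hbot
  right
  let Y' : Submodule G (AlgebraicClosure G) := (Y.map e.symm.toLinearMap).map V.subtype
  have hfrY : finrank G Y' = finrank G Y := by
    rw [Submodule.finrank_map_subtype_eq]
    exact LinearEquiv.finrank_map_eq e.symm Y
  have h1 : r ≤ finrank G Y' := by
    rw [← hfd]
    refine natDegree_le_finrank_of_stable f hf Y' ?_ ?_ ?_
    · intro h
      rw [h, finrank_bot] at hfrY
      exact hbot (Submodule.finrank_eq_zero.1 hfrY.symm)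
    · rintro _ ⟨y, -, rfl⟩
      exact y.2
    · rintro _ ⟨_, ⟨y, hy, rfl⟩, rfl⟩
      exact ⟨_, ⟨g y, hY y hy, rfl⟩, by simp [g]⟩
  apply Submodule.eq_top_of_finrank_eq
  rw [Module.finrank_fin_fun]
  refine le_antisymm (by simpa using Y.finrank_le) (hfrY ▸ h1)

end SimpleSemilinear

/-! ### Scattered subspaces and codes of distance at least three -/

section Scattered

variable {K G L : Type*} [Field K] [Field G] [Field L] [Algebra K G] [Algebra G L] [Algebra K L]
  [IsScalarTower K G L] {r : ℕ} {σ : G →ₐ[K] G}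

/-- The `K`-linear map `G ^ r → L ^ r`, `x ↦ x + ω g(x)`. -/
noncomputable def twist (ω : L) (g : (Fin r → G) →ₛₗ[(σ : G →+* G)] (Fin r → G)) :
    (Fin r → G) →ₗ[K] (Fin r → L) where
  toFun x k := algebraMap G L (x k) + ω * algebraMap G L (g x k)
  map_add' x y := by
    ext k
    simp only [map_add, Pi.add_apply]
    ring
  map_smul' c x := by
    have h : g (c • x) = c • g x := by
      rw [← algebraMap_smul G c x, g.map_smulₛₗ]
      simp
    ext k
    rw [h]
    simp only [Pi.smul_apply, RingHom.id_apply]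
    simp only [Algebra.smul_def, map_mul, ← IsScalarTower.algebraMap_apply K G L]
    ring

theorem twist_apply (ω : L) (g : (Fin r → G) →ₛₗ[(σ : G →+* G)] (Fin r → G)) (x : Fin r → G)
    (k : Fin r) : twist ω g x k = algebraMap G L (x k) + ω * algebraMap G L (g x k) := rfl

theorem eq_zero_of_add_mul_eq_zero {ω : L} (hω : ω ∉ Set.range (algebraMap G L)) {a b : G}
    (h : algebraMap G L a + ω * algebraMap G L b = 0) : a = 0 ∧ b = 0 := by
  have hb : b = 0 := by
    by_contra hb
    apply hω
    refine ⟨-a / b, ?_⟩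
    have hb' : algebraMap G L b ≠ 0 := by simpa using hb
    rw [map_div₀, map_neg, div_eq_iff hb']
    linear_combination -h
  subst hb
  simpa using h

theorem exists_eq_add_mul {ω : L} (hω : ω ∉ Set.range (algebraMap G L)) (h2 : finrank G L = 2)
    (z : L) : ∃ a b : G, z = algebraMap G L a + ω * algebraMap G L b := by
  have hli : LinearIndependent G ![1, ω] := by
    rw [LinearIndependent.pair_iff]
    intro a b h
    apply eq_zero_of_add_mul_eq_zero hω
    simpa [Algebra.smul_def, mul_comm] using h
  have hfd : FiniteDimensional G L := Module.finite_of_finrank_pos (by omega)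
  have hs := hli.span_eq_top_of_card_eq_finrank' (by simp [h2])
  have hz : z ∈ span G (Set.range ![1, ω]) := hs ▸ mem_top
  rw [Matrix.range_cons, Matrix.range_cons, Matrix.range_empty, Set.union_empty,
    Set.singleton_union, mem_span_pair] at hz
  obtain ⟨a, b, rfl⟩ := hz
  exact ⟨a, b, by simp [Algebra.smul_def, mul_comm]⟩

theorem twist_injective {ω : L} (hω : ω ∉ Set.range (algebraMap G L))
    (g : (Fin r → G) →ₛₗ[(σ : G →+* G)] (Fin r → G)) {x : Fin r → G} (h : twist ω g x = 0) :
    x = 0 :=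
  funext fun k => (eq_zero_of_add_mul_eq_zero hω (congrFun h k)).1

/-- Otherwise `span {y, g y}` is a nonzero stable subspace of dimension at most `2 < r`. -/
theorem eq_zero_of_mem_span_pair {g : (Fin r → G) →ₛₗ[(σ : G →+* G)] (Fin r → G)}
    (hr : 3 ≤ r)
    (hg : ∀ Y : Submodule G (Fin r → G), (∀ y ∈ Y, g y ∈ Y) → Y = ⊥ ∨ Y = ⊤)
    {y : Fin r → G} (h : g (g y) ∈ span G {y, g y}) : y = 0 := by
  have hle : span G {y, g y} ≤ (span G {y, g y}).comap g := by
    rw [span_le]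
    rintro z (rfl | rfl)
    · exact subset_span (by simp)
    · exact h
  rcases hg _ hle with h0 | h0
  · have : y ∈ span G {y, g y} := subset_span (by simp)
    rw [h0] at this
    simpa using this
  · have h1 := finrank_range_le_card (R := G) ![y, g y]
    rw [Set.finrank, Matrix.range_cons, Matrix.range_cons, Matrix.range_empty, Set.union_empty,
      Set.singleton_union, h0, finrank_top, Module.finrank_fin_fun, Fintype.card_fin] at h1
    omega

/-- The image of `twist` is a scattered subspace. -/
theorem twist_scattered {ω : L} (hω : ω ∉ Set.range (algebraMap G L)) (h2 : finrank G L = 2)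
    (hσ : ∀ a, σ a = a → a ∈ Set.range (algebraMap K G))
    {g : (Fin r → G) →ₛₗ[(σ : G →+* G)] (Fin r → G)} (hr : 3 ≤ r)
    (hg : ∀ Y : Submodule G (Fin r → G), (∀ y ∈ Y, g y ∈ Y) → Y = ⊥ ∨ Y = ⊤)
    {x y : Fin r → G} (hy : y ≠ 0) {z : L} (h : twist ω g x = z • twist ω g y) :
    z ∈ Set.range (algebraMap K L) := by
  obtain ⟨p, q, hz⟩ := exists_eq_add_mul hω h2 z
  obtain ⟨B, A, hAB⟩ := exists_eq_add_mul hω h2 (ω * ω)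
  have hB : B ≠ 0 := by
    rintro rfl
    have h3 : ω * (ω - algebraMap G L A) = 0 := by
      rw [map_zero] at hAB
      linear_combination hAB
    rcases mul_eq_zero.1 h3 with h4 | h4
    · exact hω ⟨0, by simp [h4]⟩
    · exact hω ⟨A, (sub_eq_zero.1 h4).symm⟩
  -- Comparison of coordinates in the `G`-basis `1, ω`, using `z = p + ω q` and `ω² = B + ω A`.
  have key : ∀ k, x k = p * y k + q * B * g y k ∧ g x k = q * y k + (p + q * A) * g y k := by
    intro k
    have h1 := congrFun h k
    rw [Pi.smul_apply, smul_eq_mul, twist_apply, twist_apply, hz] at h1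
    have h3 := eq_zero_of_add_mul_eq_zero hω (a := x k - (p * y k + q * B * g y k))
      (b := g x k - (q * y k + (p + q * A) * g y k)) (by
        simp only [map_sub, map_add, map_mul]
        linear_combination h1 + algebraMap G L q * algebraMap G L (g y k) * hAB)
    exact ⟨sub_eq_zero.1 h3.1, sub_eq_zero.1 h3.2⟩
  have hx : x = p • y + (q * B) • g y := by
    ext k; simp [(key k).1]
  have hgx : g x = q • y + (p + q * A) • g y := by
    ext k; simp [(key k).2]
  have hgx' : g x = σ p • g y + σ (q * B) • g (g y) := by
    rw [hx, map_add, g.map_smulₛₗ, g.map_smulₛₗ]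
    rfl
  -- Two expressions for `g x` are now available; if `q ≠ 0`, they put `g (g y)` in the span of `y`
  -- and `g y`.
  have hq : q = 0 := by
    by_contra hq
    apply hy
    apply eq_zero_of_mem_span_pair hr hg
    have hne : σ (q * B) ≠ 0 := by
      rw [Ne, map_eq_zero]
      exact mul_ne_zero hq hB
    rw [mem_span_pair]
    refine ⟨(σ (q * B))⁻¹ * q, (σ (q * B))⁻¹ * (p + q * A - σ p), ?_⟩
    rw [mul_smul, mul_smul, ← smul_add, inv_smul_eq_iff₀ hne, sub_smul]
    rw [hgx] at hgx'
    rw [← add_sub_assoc, hgx', add_sub_cancel_left]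
  have hp : σ p = p := by
    by_contra hp
    have h3 : (σ p - p) • g y = 0 := by
      rw [hgx, hq] at hgx'
      simp only [zero_smul, zero_add, zero_mul, add_zero, map_zero] at hgx'
      rw [sub_smul, hgx', sub_self]
    have h4 : g y = 0 := (smul_eq_zero.1 h3).resolve_left (sub_ne_zero.2 hp)
    exact hy (eq_zero_of_mem_span_pair hr hg (by simp [h4]))
  obtain ⟨c, rfl⟩ := hσ p hp
  exact ⟨c, by rw [hz, hq, map_zero, mul_zero, add_zero, IsScalarTower.algebraMap_apply K G L]⟩

/-- A relation with two terms makes two vectors of `U` proportional with factor `-b 1 / b 0`;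
scatteredness puts it in `K`, against independence of `b`. -/
theorem eq_zero_of_sum_smul_twist_eq_zero {ω : L} (hω : ω ∉ Set.range (algebraMap G L))
    (h2 : finrank G L = 2) (hσ : ∀ a, σ a = a → a ∈ Set.range (algebraMap K G))
    {g : (Fin r → G) →ₛₗ[(σ : G →+* G)] (Fin r → G)} (hr : 3 ≤ r)
    (hg : ∀ Y : Submodule G (Fin r → G), (∀ y ∈ Y, g y ∈ Y) → Y = ⊥ ∨ Y = ⊤)
    {d : ℕ} (hd : d ≤ 2) {b : Fin d → L} (hb : LinearIndependent K b) {x : Fin d → Fin r → G}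
    (h : ∑ k, b k • twist ω g (x k) = 0) : ∀ k, x k = 0 := by
  have hb0 : ∀ k, b k ≠ 0 := fun k => hb.ne_zero k
  interval_cases d
  · exact fun k => k.elim0
  · rw [Fin.sum_univ_one, smul_eq_zero] at h
    intro k
    rw [Subsingleton.elim k 0]
    exact twist_injective hω g (h.resolve_left (hb0 0))
  · rw [Fin.sum_univ_two] at h
    have h1 : x 1 = 0 := by
      by_contra h1
      have h3 : twist ω g (x 0) = (-(b 1) / b 0) • twist ω g (x 1) := by
        rw [div_eq_inv_mul, mul_smul, eq_inv_smul_iff₀ (hb0 0), neg_smul]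
        exact eq_neg_of_add_eq_zero_left h
      obtain ⟨c, hc⟩ := twist_scattered hω h2 hσ hr hg h1 h3
      rw [eq_div_iff (hb0 0)] at hc
      have h4 := Fintype.linearIndependent_iff.1 hb ![c, 1] (by
        rw [Fin.sum_univ_two]
        simp [Algebra.smul_def, hc]) 1
      simp at h4
    have h0 : x 0 = 0 := by
      rw [h1, map_zero, smul_zero, add_zero, smul_eq_zero] at h
      exact twist_injective hω g (h.resolve_left (hb0 0))
    intro k
    fin_cases k
    · exact h0
    · exact h1

/-- Codes of distance at least `3` from scattered subspaces. -/
theorem HasCode.of_twist_two [FiniteDimensional K G] [FiniteDimensional K L] {ω : L}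
    (hω : ω ∉ Set.range (algebraMap G L)) (h2 : finrank G L = 2)
    (hσ : ∀ a, σ a = a → a ∈ Set.range (algebraMap K G))
    {g : (Fin r → G) →ₛₗ[(σ : G →+* G)] (Fin r → G)} (hr : 3 ≤ r)
    (hg : ∀ Y : Submodule G (Fin r → G), (∀ y ∈ Y, g y ∈ Y) → Y = ⊥ ∨ Y = ⊤) :
    HasCode K L (r * finrank K G) (r * finrank K G - r) 2 := by
  have hn : finrank K (Fin r → G) = r * finrank K G := by
    simp [Module.finrank_pi_fintype]
  let β : Basis (Fin (r * finrank K G)) K (Fin r → G) := finBasisOfFinrankEq K _ hn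
  let Ψ := Fintype.linearCombination L (fun j => twist ω g (β j))
  refine ⟨LinearMap.ker Ψ, ?_, ?_⟩
  · have h1 := LinearMap.finrank_range_add_finrank_ker Ψ
    have h3 := (LinearMap.range Ψ).finrank_le
    rw [Module.finrank_fin_fun] at h1 h3
    omega
  intro c hc hc0
  by_contra! hrk
  apply hc0
  let S := span K (Set.range c)
  let b := finBasis K S
  have hd : finrank K S ≤ 2 := hrk
  let cS : Fin (r * finrank K G) → S := fun j => ⟨c j, subset_span ⟨j, rfl⟩⟩
  -- Expanding a word of rank at most 2 in a basis of the span of its entries turns the parity check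
  -- into a relation between at most two vectors of `U`.
  let X : Fin (finrank K S) → Fin r → G := fun k => ∑ j, b.repr (cS j) k • β j
  have hcj : ∀ j, c j = ∑ k, b.repr (cS j) k • (b k : L) := by
    intro j
    have := congrArg (Subtype.val) (b.sum_repr (cS j))
    rw [← show ((cS j : S) : L) = c j from rfl, ← this]
    simp only [AddSubmonoidClass.coe_finsetSum, Submodule.coe_smul]
  have hsum : ∑ k, (b k : L) • twist ω g (X k) = 0 := by
    have h1 : Ψ c = 0 := hc
    rw [Fintype.linearCombination_apply] at h1
    rw [← h1]
    simp only [X, map_sum, map_smul, Finset.smul_sum]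
    rw [Finset.sum_comm]
    refine Finset.sum_congr rfl fun j _ => ?_
    conv_rhs => rw [hcj j, Finset.sum_smul]
    refine Finset.sum_congr rfl fun k _ => ?_
    rw [smul_comm, smul_assoc]
  have hX : ∀ k, X k = 0 := eq_zero_of_sum_smul_twist_eq_zero hω h2 hσ hr hg hd
    (b.linearIndependent.map' S.subtype (Submodule.ker_subtype S)) hsum
  ext j
  rw [hcj j]
  refine Finset.sum_eq_zero fun k _ => ?_
  have h1 := Fintype.linearIndependent_iff.1 β.linearIndependent _ (hX k) j
  rw [h1, zero_smul]

end Scattered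

/-! ### Trace relations and annihilators -/

section TraceDual

variable {K G L : Type*} [Field K] [Field G] [Field L] [Algebra K G] [Algebra G L] {r : ℕ}
  {σ : G →ₐ[K] G}

theorem eq_zero_of_trace_mul_eq_zero {F E : Type*} [Field F] [Field E] [Algebra F E]
    [FiniteDimensional F E] [Algebra.IsSeparable F E] {w : E}
    (h : ∀ z, Algebra.trace F E (z * w) = 0) : w = 0 := by
  apply (traceForm_nondegenerate F E).1 w
  intro z
  rw [Algebra.traceForm_apply, mul_comm]
  exact h z

/-- The elements `z` such that `z` times the image of `h` has trace zero. -/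
noncomputable def traceAnnihilator (G : Type*) {L : Type*} [Field G] [Field L] [Algebra G L]
    (h : Fin r → L) : Submodule G L where
  carrier := {z | ∀ x, Algebra.trace G L (z * Fintype.linearCombination G h x) = 0}
  add_mem' := fun {z w} hz hw x => by rw [add_mul, map_add, hz x, hw x, add_zero]
  zero_mem' := fun x => by rw [zero_mul, map_zero]
  smul_mem' := fun c z hz x => by rw [smul_mul_assoc, map_smul, hz x, smul_zero]

theorem eq_zero_of_forall_linearCombination_eq_zero {h : Fin r → L}
    (h0 : ∀ x, Fintype.linearCombination G h x = 0) : h = 0 := by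
  ext k
  have := h0 (Pi.single k 1)
  rwa [Fintype.linearCombination_apply_single, one_smul] at this

theorem traceAnnihilator_ne_top [FiniteDimensional G L] [Algebra.IsSeparable G L] {h : Fin r → L}
    (hh : h ≠ 0) : traceAnnihilator G h ≠ ⊤ := by
  intro htop
  refine hh (eq_zero_of_forall_linearCombination_eq_zero (G := G) fun x => ?_)
  apply eq_zero_of_trace_mul_eq_zero (F := G)
  intro z
  have : z ∈ traceAnnihilator G h := htop ▸ mem_top
  exact this x

/-- The kernel of `x ↦ h ⬝ x` is nonzero because `r > [L : G]` and proper because `h ≠ 0`, so it is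
not stable. -/
theorem exists_linearCombination_eq_zero_and_ne [FiniteDimensional G L]
    {g : (Fin r → G) →ₛₗ[(σ : G →+* G)] (Fin r → G)}
    (hg : ∀ Y : Submodule G (Fin r → G), (∀ y ∈ Y, g y ∈ Y) → Y = ⊥ ∨ Y = ⊤)
    (hr : finrank G L < r) {h : Fin r → L} (hh : h ≠ 0) :
    ∃ x, Fintype.linearCombination G h x = 0 ∧ Fintype.linearCombination G h (g x) ≠ 0 := by
  by_contra! hst
  rcases hg (LinearMap.ker (Fintype.linearCombination G h)) hst with h0 | h0
  · have := LinearMap.finrank_le_finrank_of_injective (LinearMap.ker_eq_bot.1 h0)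
    rw [Module.finrank_fin_fun] at this
    omega
  · exact hh (eq_zero_of_forall_linearCombination_eq_zero (G := G) fun x => by
      have : x ∈ LinearMap.ker (Fintype.linearCombination G h) := h0 ▸ mem_top
      exact this)

theorem mem_traceAnnihilator_of_comp
    {g : (Fin r → G) →ₛₗ[(σ : G →+* G)] (Fin r → G)}
    (hg : ∀ Y : Submodule G (Fin r → G), (∀ y ∈ Y, g y ∈ Y) → Y = ⊥ ∨ Y = ⊤)
    (hr : 2 ≤ r) {h : Fin r → L} {z : L}
    (hz : ∀ x, Algebra.trace G L (z * Fintype.linearCombination G h (g x)) = 0) :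
    z ∈ traceAnnihilator G h := by
  let F : (Fin r → G) →ₗ[G] G :=
    (Algebra.trace G L).comp ((LinearMap.mulLeft G z).comp (Fintype.linearCombination G h))
  rcases hg (LinearMap.ker F) (fun y _ => hz y) with h0 | h0
  · have := LinearMap.finrank_le_finrank_of_injective (LinearMap.ker_eq_bot.1 h0)
    rw [Module.finrank_fin_fun, Module.finrank_self] at this
    omega
  · intro x
    have : x ∈ LinearMap.ker F := h0 ▸ mem_top
    exact this

/-- Comparing the two relations gives `(σ ρ - ρ) * σ (Tr (μ (h ⬝ x))) = 0`, so both sides of the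
first vanish. -/
theorem mem_traceAnnihilator_of_smul {ω : L}
    {g : (Fin r → G) →ₛₗ[(σ : G →+* G)] (Fin r → G)}
    (hg : ∀ Y : Submodule G (Fin r → G), (∀ y ∈ Y, g y ∈ Y) → Y = ⊥ ∨ Y = ⊤)
    (hr : 2 ≤ r) {h : Fin r → L} {μ : L} {ρ : G} (hρ : σ ρ ≠ ρ)
    (h1 : ∀ x, σ (Algebra.trace G L (μ * Fintype.linearCombination G h x)) =
      -Algebra.trace G L (μ * ω * Fintype.linearCombination G h (g x)))
    (h2 : ∀ x, σ (Algebra.trace G L ((ρ • μ) * Fintype.linearCombination G h x)) =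
      -Algebra.trace G L ((ρ • μ) * ω * Fintype.linearCombination G h (g x))) :
    μ ∈ traceAnnihilator G h ∧ μ * ω ∈ traceAnnihilator G h := by
  have h3 : μ ∈ traceAnnihilator G h := by
    intro x
    have h4 := h2 x
    simp only [smul_mul_assoc] at h4
    rw [(Algebra.trace G L).map_smul, (Algebra.trace G L).map_smul, smul_eq_mul, smul_eq_mul,
      map_mul, ← mul_neg, ← h1 x] at h4
    rw [← map_eq_zero σ]
    by_contra hne
    exact hρ (mul_right_cancel₀ hne h4)
  refine ⟨h3, mem_traceAnnihilator_of_comp hg hr fun x => ?_⟩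
  have h4 := h1 x
  rw [h3 x, map_zero] at h4
  exact neg_eq_zero.1 h4.symm

theorem notMem_range_of_adjoin_eq_top {ω : L} (hω : Algebra.adjoin G {ω} = ⊤)
    (h1 : finrank G L ≠ 1) : ω ∉ Set.range (algebraMap G L) := by
  rintro ⟨a, rfl⟩
  have h2 : Algebra.adjoin G {algebraMap G L a} = ⊥ := by
    rw [eq_bot_iff, Algebra.adjoin_le_iff, Set.singleton_subset_iff]
    exact Subalgebra.algebraMap_mem _ a
  rw [h2] at hω
  exact h1 (Subalgebra.bot_eq_top_iff_finrank_eq_one.1 hω)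

theorem two_le_finrank_of_mem [FiniteDimensional G L] {ω : L}
    (hω : ω ∉ Set.range (algebraMap G L)) {J : Submodule G L} {μ : L} (hμ : μ ≠ 0) (h1 : μ ∈ J)
    (h2 : μ * ω ∈ J) : 2 ≤ finrank G J := by
  have hli : LinearIndependent G ![μ, μ * ω] := by
    rw [LinearIndependent.pair_iff]
    intro a b h
    apply eq_zero_of_add_mul_eq_zero hω
    have h3 : μ * (algebraMap G L a + ω * algebraMap G L b) = 0 := by
      rw [← h, Algebra.smul_def, Algebra.smul_def]
      ring
    exact (mul_eq_zero.1 h3).resolve_left hμ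
  have h3 := finrank_span_eq_card hli
  rw [Fintype.card_fin] at h3
  refine h3.symm.trans_le (Submodule.finrank_mono (span_le.2 ?_))
  rintro _ ⟨k, rfl⟩
  fin_cases k
  · exact h1
  · exact h2

/-- If the `G`-span of the trace dual is everything, the kernel of the form is stable. -/
theorem span_ne_top_of_trace_dual [FiniteDimensional G L] [Algebra.IsSeparable G L] {ω : L}
    (hω : ω ≠ 0) {g : (Fin r → G) →ₛₗ[(σ : G →+* G)] (Fin r → G)}
    (hg : ∀ Y : Submodule G (Fin r → G), (∀ y ∈ Y, g y ∈ Y) → Y = ⊥ ∨ Y = ⊤)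
    (hr : finrank G L < r) {h : Fin r → L} (hh : h ≠ 0) {S : Set L}
    (hS : ∀ μ ∈ S, ∀ x, σ (Algebra.trace G L (μ * Fintype.linearCombination G h x)) =
      -Algebra.trace G L (μ * ω * Fintype.linearCombination G h (g x))) : span G S ≠ ⊤ := by
  intro htop
  obtain ⟨x, hx, hgx⟩ := exists_linearCombination_eq_zero_and_ne hg hr hh
  have h1 : ∀ z ∈ span G S, Algebra.trace G L (z * (ω * Fintype.linearCombination G h (g x))) = 0 := by
    intro z hz
    induction hz using span_induction with
    | mem z hz =>
      have := hS z hz x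
      rw [hx, mul_zero, map_zero, map_zero, mul_assoc] at this
      exact neg_eq_zero.1 this.symm
    | zero => simp
    | add a b _ _ ha hb => rw [add_mul, map_add, ha, hb, add_zero]
    | smul c a _ ha => rw [smul_mul_assoc, map_smul, ha, smul_zero]
  have h2 := eq_zero_of_trace_mul_eq_zero (F := G) fun z => h1 z (htop ▸ mem_top)
  exact hgx ((mul_eq_zero.1 h2).resolve_left hω)

end TraceDual

/-! ### Ranks of the twisted forms -/

section Functionals

variable {K G L : Type*} [Field K] [Field G] [Field L] [Algebra K G] [Algebra G L] [Algebra K L]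
  [IsScalarTower K G L] {r i : ℕ} {σ : G →ₐ[K] G}

/-- The `K`-linear map `x ↦ h ⬝ (x + ω g(x))` on `G ^ r`. -/
noncomputable def twistForm (ω : L) (g : (Fin r → G) →ₛₗ[(σ : G →+* G)] (Fin r → G))
    (h : Fin r → L) : (Fin r → G) →ₗ[K] L :=
  ((Fintype.linearCombination L h).restrictScalars K).comp (twist ω g)

theorem twistForm_apply (ω : L) (g : (Fin r → G) →ₛₗ[(σ : G →+* G)] (Fin r → G)) (h : Fin r → L)
    (x : Fin r → G) : twistForm ω g h x =
      Fintype.linearCombination G h x + ω * Fintype.linearCombination G h (g x) := by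
  simp only [twistForm, LinearMap.comp_apply, LinearMap.restrictScalars_apply,
    Fintype.linearCombination_apply, twist_apply, smul_eq_mul, Algebra.smul_def, add_mul,
    Finset.sum_add_distrib, Finset.mul_sum, mul_assoc]

theorem HasCode.of_twistForm [FiniteDimensional K G] [FiniteDimensional K L] {ω : L}
    {g : (Fin r → G) →ₛₗ[(σ : G →+* G)] (Fin r → G)}
    (hrk : ∀ h : Fin r → L, h ≠ 0 → i < finrank K (LinearMap.range (twistForm ω g h))) :
    HasCode K L (r * finrank K G) r i := by
  have hn : finrank K (Fin r → G) = r * finrank K G := by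
    simp [Module.finrank_pi_fintype]
  let β : Basis (Fin (r * finrank K G)) K (Fin r → G) := finBasisOfFinrankEq K _ hn
  let E : (Fin r → L) →ₗ[L] (Fin (r * finrank K G) → L) :=
    { toFun := fun h j => twistForm ω g h (β j)
      map_add' := fun h h' => by
        ext j
        simp [twistForm, Fintype.linearCombination_apply, mul_add, Finset.sum_add_distrib]
      map_smul' := fun c h => by
        ext j
        simp [twistForm, Fintype.linearCombination_apply, Finset.mul_sum, mul_left_comm] }
  have key : ∀ h, h ≠ 0 → i < rk K (E h) := by
    intro h hh
    have h1 := rk_map (twistForm ω g h) β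
    rw [β.span_eq, ← LinearMap.range_eq_map] at h1
    exact (hrk h hh).trans_eq h1.symm
  refine ⟨LinearMap.range E, ?_, ?_⟩
  · rw [LinearMap.finrank_range_of_inj]
    · simp
    · rw [← LinearMap.ker_eq_bot, LinearMap.ker_eq_bot']
      intro h h0
      by_contra hh
      have := key h hh
      rw [h0] at this
      have h3 : rk K (0 : Fin (r * finrank K G) → L) = 0 := by
        rw [rk, Submodule.finrank_eq_zero, span_eq_bot]
        rintro _ ⟨j, rfl⟩; rfl
      omega
  · rintro _ ⟨h, rfl⟩ h0
    exact key h (by rintro rfl; simp at h0)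

/-- An element trace-orthogonal to the image of a twisted form satisfies a semilinear relation. -/
theorem map_trace_eq_neg [Finite K] [FiniteDimensional K G] [FiniteDimensional G L]
    [FiniteDimensional K L] {ω : L} {g : (Fin r → G) →ₛₗ[(σ : G →+* G)] (Fin r → G)} {h : Fin r → L}
    {μ : L} (hμ : ∀ x, Algebra.trace K L (twistForm ω g h x * μ) = 0) (x : Fin r → G) :
    σ (Algebra.trace G L (μ * Fintype.linearCombination G h x)) =
      -Algebra.trace G L (μ * ω * Fintype.linearCombination G h (g x)) := by
  have : Finite G := Module.finite_of_finite K
  set A := Algebra.trace G L (μ * Fintype.linearCombination G h x) with hA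
  set B := Algebra.trace G L (μ * ω * Fintype.linearCombination G h (g x)) with hB
  let e : G ≃ₐ[K] G := AlgEquiv.ofBijective σ (Finite.injective_iff_bijective.1 σ.injective)
  have he : ∀ a, e a = σ a := fun a => rfl
  -- Orthogonality at `a • x` reads `Tr (a A + σ(a) B) = 0`; invariance of the trace under `σ`
  -- rewrites `a A` as `σ(a) σ(A)`.
  have h1 : ∀ a, Algebra.trace K G (σ a * (σ A + B)) = 0 := by
    intro a
    have h2 := hμ (a • x)
    rw [twistForm_apply, map_smul, g.map_smulₛₗ, map_smul, ← Algebra.trace_trace (S := G)] at h2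
    have h3 : Algebra.trace G L ((a • Fintype.linearCombination G h x +
        ω * (σ a • Fintype.linearCombination G h (g x))) * μ) = a * A + σ a * B := by
      have h5 : (a • Fintype.linearCombination G h x +
          ω * (σ a • Fintype.linearCombination G h (g x))) * μ =
          a • (μ * Fintype.linearCombination G h x) +
            σ a • (μ * ω * Fintype.linearCombination G h (g x)) := by
        simp only [Algebra.smul_def]
        ring
      rw [h5, map_add, map_smul, map_smul, smul_eq_mul, smul_eq_mul]
    have h4 : Algebra.trace K G (σ a * σ A) = Algebra.trace K G (a * A) := by
      rw [← map_mul, ← he, Algebra.trace_eq_of_algEquiv]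
    rw [mul_add, map_add, h4, ← map_add, ← h3]
    exact h2
  rw [eq_neg_iff_add_eq_zero]
  apply eq_zero_of_trace_mul_eq_zero (F := K)
  intro z
  rw [← e.apply_symm_apply z]
  exact h1 _

theorem finrank_range_add_finrank_dual [Finite K] [FiniteDimensional K L] {V : Type*}
    [AddCommGroup V] [Module K V] (f : V →ₗ[K] L) :
    ∃ S : Submodule K L, finrank K (LinearMap.range f) + finrank K S = finrank K L ∧
      ∀ μ ∈ S, ∀ x, Algebra.trace K L (f x * μ) = 0 := by
  refine ⟨(Algebra.traceForm K L).orthogonal (LinearMap.range f), ?_, ?_⟩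
  · rw [LinearMap.BilinForm.finrank_orthogonal (traceForm_nondegenerate K L)]
    have := (LinearMap.range f).finrank_le
    omega
  · intro μ hμ x
    exact hμ _ ⟨x, rfl⟩

/-- Two `K`-independent elements of the trace dual `S` lie on one `G`-line, so they are `μ` and `ρ
μ` with `σ ρ ≠ ρ`. Then `μ` and `μ ω` both lie in the proper annihilator, which has dimension at
most 1. -/
theorem finrank_range_twistForm_of_finrank_eq_two [Finite K] [FiniteDimensional K G]
    [FiniteDimensional G L] [FiniteDimensional K L] {ω : L}
    (hω : ω ∉ Set.range (algebraMap G L)) (h2 : finrank G L = 2)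
    (hσ : ∀ a, σ a = a → a ∈ Set.range (algebraMap K G))
    {g : (Fin r → G) →ₛₗ[(σ : G →+* G)] (Fin r → G)} (hr : 3 ≤ r)
    (hg : ∀ Y : Submodule G (Fin r → G), (∀ y ∈ Y, g y ∈ Y) → Y = ⊥ ∨ Y = ⊤)
    {h : Fin r → L} (hh : h ≠ 0) :
    finrank K L ≤ finrank K (LinearMap.range (twistForm ω g h)) + 1 := by
  have : Finite G := Module.finite_of_finite K
  obtain ⟨S, hSr, hS⟩ := finrank_range_add_finrank_dual (twistForm ω g h)
  by_contra! hlt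
  have hS2 : 2 ≤ finrank K S := by omega
  have hS' : ∀ μ ∈ S, ∀ x, σ (Algebra.trace G L (μ * Fintype.linearCombination G h x)) =
      -Algebra.trace G L (μ * ω * Fintype.linearCombination G h (g x)) :=
    fun μ hμ x => map_trace_eq_neg (hS μ hμ) x
  have hω0 : ω ≠ 0 := by rintro rfl; exact hω ⟨0, map_zero _⟩
  have htop := span_ne_top_of_trace_dual (S := S) hω0 hg (by omega) hh hS'
  obtain ⟨μ, hμ, hμ0⟩ : ∃ μ ∈ S, μ ≠ 0 := by
    apply exists_mem_ne_zero_of_ne_bot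
    rintro rfl
    simp at hS2
  obtain ⟨μ', hμ', hμμ'⟩ : ∃ μ' ∈ S, μ' ∉ span K {μ} := by
    by_contra! hle
    have h3 := Submodule.finrank_mono (show S ≤ span K {μ} from hle)
    rw [finrank_span_singleton hμ0] at h3
    omega
  have hspan : span G {μ} = span G (S : Set L) := by
    apply Submodule.eq_of_le_of_finrank_le (span_mono (by simpa using hμ))
    rw [finrank_span_singleton hμ0]
    have := Submodule.finrank_lt htop
    omega
  obtain ⟨ρ, rfl⟩ : ∃ ρ : G, ρ • μ = μ' := by
    rw [← mem_span_singleton, hspan]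
    exact subset_span hμ'
  have hρ : σ ρ ≠ ρ := by
    intro h3
    obtain ⟨c, rfl⟩ := hσ ρ h3
    exact hμμ' (mem_span_singleton.2 ⟨c, by rw [algebraMap_smul]⟩)
  obtain ⟨h3, h4⟩ := mem_traceAnnihilator_of_smul hg (by omega) hρ (hS' μ hμ) (hS' _ hμ')
  have h5 := two_le_finrank_of_mem hω hμ0 h3 h4
  have h6 := Submodule.finrank_lt (traceAnnihilator_ne_top (G := G) hh)
  omega

theorem finrank_range_twistForm_of_finrank_eq_three [Finite K] [FiniteDimensional K G]
    [FiniteDimensional G L] [FiniteDimensional K L] {ω : L}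
    (hω : Algebra.adjoin G {ω} = ⊤) (h3 : finrank G L = 3) (hG : finrank K G = 2)
    (hσ : ∀ a, σ a = a → a ∈ Set.range (algebraMap K G))
    {g : (Fin r → G) →ₛₗ[(σ : G →+* G)] (Fin r → G)} (hr : 4 ≤ r)
    (hg : ∀ Y : Submodule G (Fin r → G), (∀ y ∈ Y, g y ∈ Y) → Y = ⊥ ∨ Y = ⊤)
    {h : Fin r → L} (hh : h ≠ 0) :
    finrank K L ≤ finrank K (LinearMap.range (twistForm ω g h)) + 2 := by
  have : Finite G := Module.finite_of_finite K
  have hωr := notMem_range_of_adjoin_eq_top hω (by omega)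
  obtain ⟨S, hSr, hS⟩ := finrank_range_add_finrank_dual (twistForm ω g h)
  by_contra! hlt
  have hS3 : 3 ≤ finrank K S := by omega
  have hS' : ∀ μ ∈ S, ∀ x, σ (Algebra.trace G L (μ * Fintype.linearCombination G h x)) =
      -Algebra.trace G L (μ * ω * Fintype.linearCombination G h (g x)) :=
    fun μ hμ x => map_trace_eq_neg (hS μ hμ) x
  have hω0 : ω ≠ 0 := by rintro rfl; exact hωr ⟨0, map_zero _⟩
  have htop := span_ne_top_of_trace_dual (S := S) hω0 hg (by omega) hh hS'
  set T := span G (S : Set L) with hT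
  have hT2 : finrank G T ≤ 2 := by
    have := Submodule.finrank_lt htop
    omega
  have hTK : finrank K (T.restrictScalars K) = 2 * finrank G T := by
    rw [← hG]
    exact (finrank_mul_finrank K G T).symm
  have hST : S ≤ T.restrictScalars K := fun x hx => subset_span hx
  obtain ⟨θ, hθ⟩ : ∃ θ : G, σ θ ≠ θ := by
    by_contra! hall
    have h1 : (⊥ : Subalgebra K G) = ⊤ := by
      rw [eq_top_iff]
      intro a _
      exact Algebra.mem_bot.2 (hσ a (hall a))
    have h2 := Subalgebra.bot_eq_top_iff_finrank_eq_one.1 h1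
    omega
  have hθ0 : θ ≠ 0 := by rintro rfl; exact hθ (map_zero _)
  -- `S` and `θ S` have `K`-dimension at least 3 inside `T`, of `K`-dimension at most 4, so they
  -- meet.
  obtain ⟨μ, hμ, hμ', hμ0⟩ : ∃ μ ∈ S, θ • μ ∈ S ∧ μ ≠ 0 := by
    let m : L →ₗ[K] L := (LinearMap.lsmul G L θ).restrictScalars K
    have hm : Function.Injective m := fun x y hxy => smul_right_injective L hθ0 hxy
    have h1 := Submodule.finrank_sup_add_finrank_inf_eq S (S.map m)
    have h2 : S ⊔ S.map m ≤ T.restrictScalars K := by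
      refine sup_le hST ?_
      rintro _ ⟨x, hx, rfl⟩
      exact T.smul_mem θ (hST hx)
    have h4 := Submodule.finrank_mono h2
    rw [← (Submodule.equivMapOfInjective m hm S).finrank_eq] at h1
    have h5 : S ⊓ S.map m ≠ ⊥ := by
      intro h0
      rw [h0, finrank_bot] at h1
      omega
    obtain ⟨_, ⟨hx, ⟨μ, hμ, rfl⟩⟩, hne⟩ := exists_mem_ne_zero_of_ne_bot h5
    exact ⟨μ, hμ, hx, by rintro rfl; exact hne (map_zero _)⟩
  set J := traceAnnihilator G h with hJ
  obtain ⟨hμJ, hμωJ⟩ := mem_traceAnnihilator_of_smul hg (by omega) hθ (hS' μ hμ) (hS' _ hμ')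
  have hJ2 : 2 ≤ finrank G J := two_le_finrank_of_mem hωr hμ0 hμJ hμωJ
  have hJtop : J ≠ ⊤ := traceAnnihilator_ne_top hh
  have hJlt := Submodule.finrank_lt hJtop
  -- Otherwise `J` and `ν ω` span `L`; with `h ⬝ x = 0`, both are trace-orthogonal to `h ⬝ g x ≠ 0`.
  have hSω : ∀ ν ∈ S, ν * ω ∈ J := by
    intro ν hν
    by_contra hne
    obtain ⟨x, hx, hgx⟩ := exists_linearCombination_eq_zero_and_ne hg (by omega) hh
    have h1 : J ⊔ span G {ν * ω} = ⊤ := by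
      apply Submodule.eq_top_of_finrank_eq
      have h4 : J < J ⊔ span G {ν * ω} := by
        refine lt_of_le_not_ge le_sup_left fun h5 => hne (h5 ?_)
        exact mem_sup_right (mem_span_singleton_self _)
      have := Submodule.finrank_lt_finrank_of_lt h4
      have := (J ⊔ span G {ν * ω}).finrank_le
      omega
    apply hgx
    apply eq_zero_of_trace_mul_eq_zero (F := G)
    intro z
    have hz : z ∈ J ⊔ span G {ν * ω} := h1 ▸ mem_top
    obtain ⟨j, hj, _, hw, rfl⟩ := mem_sup.1 hz
    obtain ⟨c, rfl⟩ := mem_span_singleton.1 hw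
    have h4 := hS' ν hν x
    rw [hx, mul_zero, map_zero, map_zero] at h4
    rw [add_mul, map_add, hj, smul_mul_assoc, map_smul, neg_eq_zero.1 h4.symm, smul_zero, add_zero]
  have hSJ : ∀ ν ∈ S, ν ∈ J := by
    intro ν hν x
    have h4 := hS' ν hν x
    rw [hSω ν hν (g x), neg_zero] at h4
    exact (map_eq_zero σ).1 h4
  have hTJ : T = J := by
    apply Submodule.eq_of_le_of_finrank_le (span_le.2 hSJ)
    have := Submodule.finrank_mono hST
    change finrank G J ≤ finrank G T
    omega
  -- Since `J = T` is the `G`-span of `S`, it is stable under `ω`. As `L = G[ω]`, it is a nonzero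
  -- ideal of `L`, contradicting properness.
  have hJω : ∀ j ∈ J, j * ω ∈ J := by
    intro j hj
    rw [← hTJ, hT] at hj
    induction hj using span_induction with
    | mem z hz => exact hSω z hz
    | zero => rw [zero_mul]; exact zero_mem _
    | add a b _ _ ha hb => rw [add_mul]; exact add_mem ha hb
    | smul c a _ ha => rw [smul_mul_assoc]; exact J.smul_mem c ha
  have hall : ∀ z : L, ∀ j ∈ J, j * z ∈ J := by
    intro z
    have hz : z ∈ Algebra.adjoin G {ω} := hω ▸ Algebra.mem_top
    induction hz using Algebra.adjoin_induction with
    | mem z hz => rw [Set.mem_singleton_iff.1 hz]; exact hJω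
    | algebraMap c => intro j hj; rw [mul_comm, ← Algebra.smul_def]; exact J.smul_mem c hj
    | add a b _ _ ha hb => intro j hj; rw [mul_add]; exact add_mem (ha j hj) (hb j hj)
    | mul a b _ _ ha hb => intro j hj; rw [← mul_assoc]; exact hb _ (ha j hj)
  apply hJtop
  rw [eq_top_iff]
  intro z _
  have := hall (μ⁻¹ * z) μ hμJ
  rwa [mul_inv_cancel_left₀ hμ0] at this

end Functionals

/-! ### Existence of the codes and values of the critical exponent -/

section Existence

variable {K L : Type*} [Field K] [Field L] [Algebra K L] {n m i c k s : ℕ}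

theorem exists_intermediateField_finrank_eq [Finite K] [FiniteDimensional K L] (e : ℕ)
    (hm : finrank K L = s * e) :
    ∃ F : IntermediateField K L, finrank K F = s ∧ finrank F L = e := by
  have : Fintype K := Fintype.ofFinite K
  have : Finite L := Module.finite_of_finite K
  have hpos : 0 < s * e := hm ▸ finrank_pos
  have hs : s ≠ 0 := by rintro rfl; simp at hpos
  let φ := FiniteField.frobeniusAlgEquivOfAlgebraic K L
  -- The `s`-th power of Frobenius has order `e`.
  let F := IntermediateField.fixedField (Subgroup.zpowers (φ ^ s))
  have h1 : finrank F L = e := by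
    rw [IntermediateField.finrank_fixedField_eq_card, Nat.card_zpowers, orderOf_pow' _ hs,
      FiniteField.orderOf_frobeniusAlgEquivOfAlgebraic, hm, Nat.gcd_eq_right ⟨e, rfl⟩,
      Nat.mul_div_cancel_left _ (Nat.pos_of_ne_zero hs)]
  refine ⟨F, ?_, h1⟩
  have h2 := finrank_mul_finrank K F L
  rw [h1, hm] at h2
  exact Nat.eq_of_mul_eq_mul_right (Nat.pos_of_mul_pos_left hpos) h2

theorem exists_adjoin_eq_top (G L : Type*) [Field G] [Field L] [Algebra G L]
    [FiniteDimensional G L] [Algebra.IsSeparable G L] : ∃ ω : L, Algebra.adjoin G {ω} = ⊤ := by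
  obtain ⟨ω, hω⟩ := Field.exists_primitive_element G L
  refine ⟨ω, ?_⟩
  rw [← IntermediateField.adjoin_simple_toSubalgebra_of_isAlgebraic (IsAlgebraic.of_finite G ω), hω,
    IntermediateField.top_toSubalgebra]

theorem HasCode.of_even [Finite K] [FiniteDimensional K L] (hm : finrank K L = s * 2) :
    HasCode K L (3 * s) (3 * s - 3) 2 ∧ HasCode K L (3 * s) 3 (2 * s - 2) := by
  have : Fintype K := Fintype.ofFinite K
  obtain ⟨F, hF, hFL⟩ := exists_intermediateField_finrank_eq 2 hm
  have : Finite F := Module.finite_of_finite K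
  have : Fintype F := Fintype.ofFinite F
  obtain ⟨ω, hω⟩ := exists_adjoin_eq_top F L
  have hω' := notMem_range_of_adjoin_eq_top hω (by omega)
  obtain ⟨g, hg⟩ := exists_simple_semilinear K F (r := 3) (by omega)
  have hσ : ∀ a, FiniteField.frobeniusAlgHom K F a = a → a ∈ Set.range (algebraMap K F) :=
    fun a ha => exists_algebraMap_eq_of_frobenius F a ha
  rw [← hF]
  refine ⟨HasCode.of_twist_two hω' hFL hσ le_rfl hg, HasCode.of_twistForm (ω := ω) (g := g) ?_⟩
  intro h hh
  have h1 := finrank_range_twistForm_of_finrank_eq_two hω' hFL hσ le_rfl hg hh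
  have h2 : 0 < finrank K L := finrank_pos
  omega

theorem HasCode.of_six [Finite K] [FiniteDimensional K L] (hm : finrank K L = 6) :
    HasCode K L 8 4 3 := by
  have : Fintype K := Fintype.ofFinite K
  obtain ⟨F, hF, hFL⟩ := exists_intermediateField_finrank_eq (s := 2) 3 hm
  have : Finite F := Module.finite_of_finite K
  have : Fintype F := Fintype.ofFinite F
  obtain ⟨ω, hω⟩ := exists_adjoin_eq_top F L
  obtain ⟨g, hg⟩ := exists_simple_semilinear K F (r := 4) (by omega)
  have hσ : ∀ a, FiniteField.frobeniusAlgHom K F a = a → a ∈ Set.range (algebraMap K F) :=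
    fun a ha => exists_algebraMap_eq_of_frobenius F a ha
  have h4 : HasCode K L (4 * finrank K F) 4 3 := by
    refine HasCode.of_twistForm (ω := ω) (g := g) fun h hh => ?_
    have h1 := finrank_range_twistForm_of_finrank_eq_three hω hFL hF hσ le_rfl hg hh
    omega
  rwa [hF] at h4

theorem mul_le_crit_mul [Finite K] [FiniteDimensional K L] (hin : i ≤ n)
    (him : i ≤ finrank K L) : n * i ≤ finrank K L * crit K L n i := by
  have : Finite L := Module.finite_of_finite K
  obtain ⟨C, hC, hcrit⟩ := exists_code_of_crit (K := K) (L := L) hin him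
  have h1 := finrank_mul_le_of_forall_lt_rk C him hC
  have h2 : finrank L C ≤ n := by simpa using C.finrank_le
  rw [hcrit]
  zify [h2, him] at h1 ⊢
  linarith

theorem HasCode.crit_eq [Finite K] [FiniteDimensional K L] (hin : i ≤ n)
    (him : i ≤ finrank K L) (hc : n * i = finrank K L * c) (hk : n ≤ c + k)
    (h : HasCode K L n k i) : crit K L n i = c := by
  have : Finite L := Module.finite_of_finite K
  have h1 := h.crit_le hin him
  have h2 := mul_le_crit_mul (K := K) (L := L) hin him
  rw [hc] at h2
  have h3 := Nat.le_of_mul_le_mul_left h2 finrank_pos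
  omega

theorem crit_eq_of_le [Finite K] [FiniteDimensional K L] (hin : i ≤ n) (hnm : n ≤ finrank K L) :
    crit K L n i = i := by
  have : Fintype K := Fintype.ofFinite K
  have : Finite L := Module.finite_of_finite K
  have h1 := (HasCode.gabidulin (K := K) (L := L) (i := i) hnm).crit_le hin (hin.trans hnm)
  obtain ⟨C, hC, hcrit⟩ := exists_code_of_crit (K := K) (L := L) hin (hin.trans hnm)
  have h2 := finrank_add_le_of_forall_lt_rk C hin hC
  omega

/-- Direct sums of square Gabidulin codes. -/
theorem HasCode.replicate_gabidulin [Finite K] [FiniteDimensional K L] (t i : ℕ) :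
    HasCode K L (t * finrank K L) (t * (finrank K L - i)) i := by
  have : Fintype K := Fintype.ofFinite K
  have : Finite L := Module.finite_of_finite K
  exact (HasCode.gabidulin le_rfl).replicate t

theorem crit_eq_of_dvd [Finite K] [FiniteDimensional K L] {t : ℕ} (hn : n = t * finrank K L)
    (hin : i ≤ n) (him : i ≤ finrank K L) : crit K L n i = t * i := by
  subst hn
  refine (HasCode.replicate_gabidulin t i).crit_eq hin him (by ring) ?_
  rw [← mul_add, Nat.add_sub_cancel' him]

theorem crit_mul_eq_of_even [Finite K] [FiniteDimensional K L] (hm : finrank K L = s * 2)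
    (hn : n = s * k) (hlt : finrank K L < n) (hi : i = 2 ∨ i + 2 = finrank K L) (hin : i ≤ n) :
    finrank K L * crit K L n i = n * i := by
  have h0 : 0 < finrank K L := finrank_pos
  have hs : 0 < s := by omega
  have him : i ≤ finrank K L := by omega
  have hk : 2 < k := by
    by_contra! hk
    have := Nat.mul_le_mul_left s hk
    omega
  rcases Nat.even_or_odd' k with ⟨t, rfl | rfl⟩
  · rw [crit_eq_of_dvd (t := t) (by rw [hn, hm]; ring) hin him, hn, hm]
    ring
  -- Rewrite the odd multiplier as `2 * t + 3`: `t` square Gabidulin blocks and one block of length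
  -- `3 * s`.
  obtain ⟨t, rfl⟩ : ∃ u, t = u + 1 := ⟨t - 1, by omega⟩
  have hn' : n = t * finrank K L + 3 * s := by rw [hn, hm]; ring
  obtain ⟨hc, hc'⟩ := HasCode.of_even hm
  rcases hi with rfl | hi
  · have h1 := (HasCode.replicate_gabidulin (K := K) (L := L) t 2).append hc
    rw [← hn'] at h1
    rw [h1.crit_eq (c := 2 * t + 3) hin him (by rw [hn, hm]; ring)]
    · rw [hn, hm]; ring
    · have h2 : t * finrank K L = 2 * t + t * (finrank K L - 2) := by
        rw [mul_comm 2 t, ← mul_add, Nat.add_sub_cancel' him]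
      omega
  · obtain ⟨u, rfl⟩ : ∃ u, s = u + 1 := ⟨s - 1, by omega⟩
    obtain rfl : i = 2 * (u + 1) - 2 := by omega
    have h1 := (HasCode.replicate_gabidulin (K := K) (L := L) t (2 * (u + 1) - 2)).append hc'
    rw [← hn'] at h1
    have hi' : 2 * (u + 1) - 2 = 2 * u := by omega
    rw [h1.crit_eq (c := (2 * t + 3) * u) hin him (by rw [hn, hm, hi']; ring)]
    · rw [hn, hm, hi']; ring
    · have h2 : finrank K L - (2 * (u + 1) - 2) = 2 := by omega
      rw [hn, h2]
      apply le_of_eq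
      ring

end Existence

end RankMetric

/-! ### The main theorem -/

theorem mainTheorem5 {K L : Type*} [Field K] [Finite K] [Field L] [Algebra K L]
    (q m n i : ℕ) (hq : Nat.card K = q) (hL : Module.finrank K L = m)
    (hn : 2 ≤ n) (hm : 2 ≤ m) (hi : 1 ≤ i) (hin : i ≤ n) :
    (n ≤ m → RankMetric.crit K L n i = i) ∧
    (m < n →
      (i ≤ m → (n : ℚ) * i / m ≤ RankMetric.crit K L n i) ∧
      (m ∣ n * i →
        ((∃ t k : ℕ, n = t * m ∧ i + k = m) ∨
          (Even m ∧ (∃ k : ℕ, 2 * n = m * k) ∧ (i = 2 ∨ i + 2 = m)) ∨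
          (n = 8 ∧ m = 6 ∧ i = 3 ∧ ∃ h : ℕ, q = 2 ^ h ∧ h ≡ 1 [MOD 6]) ∨
          (n = 8 ∧ m = 4 ∧ i = 3 ∧ ∃ h : ℕ, q = 2 ^ h ∧ Odd h)) →
        (RankMetric.crit K L n i : ℚ) = (n : ℚ) * i / m)) := by
  have : FiniteDimensional K L := Module.finite_of_finrank_pos (by omega)
  have hm0 : (0 : ℚ) < m := by exact_mod_cast (by omega : 0 < m)
  subst hL
  refine ⟨fun h => RankMetric.crit_eq_of_le hin h, fun hlt => ⟨fun him => ?_, fun _ h => ?_⟩⟩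
  · rw [div_le_iff₀ hm0, mul_comm (RankMetric.crit K L n i : ℚ)]
    exact_mod_cast RankMetric.mul_le_crit_mul hin him
  · rw [eq_div_iff hm0.ne', mul_comm (RankMetric.crit K L n i : ℚ)]
    norm_cast
    rcases h with ⟨t, k, ht, hk⟩ | ⟨⟨s, hs⟩, ⟨k, hk⟩, hi2⟩ | ⟨rfl, h6, rfl, -⟩ | ⟨rfl, h4, rfl, -⟩
    · rw [RankMetric.crit_eq_of_dvd ht hin (by omega), ht]
      ring
    · have hs2 : Module.finrank K L = s * 2 := by omega
      refine RankMetric.crit_mul_eq_of_even (k := k) hs2 ?_ hlt hi2 hin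
      rw [hs2] at hk
      linarith
    · rw [(RankMetric.HasCode.of_six h6).crit_eq (c := 4) hin (by omega) (by omega) (by omega), h6]
    -- Here `8 = 2 * 4`, so two square Gabidulin blocks suffice.
    · rw [RankMetric.crit_eq_of_dvd (t := 2) (by omega) hin (by omega), h4]
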